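/- Let $(R,\mathfrak m)$ be a noetherian local ring and let $\mathfrak q\subseteq\mathfrak m$ be an ideal with $\mathfrak m^2=\mathfrak q\mathfrak m$ and $\mathfrak q^2=0$. (1) Let $y_1,\dots,y_e$ be a minimal generating set of $\mathfrak q$. Then the collection of ideals $$\mathcal F=\{0,(y_1),(y_1,y_2),\dots,(y_1,\dots,y_{e-1})\}\ \cup\ \{I\subseteq\mathfrak m : I \text{ is an ideal containing } \mathfrak q\}$$ is a Koszul filtration of $R$, i.e. - $0\in\mathcal F$ and $\mathfrak m\in\mathcal F$; - $I\cap\mathfrak m^{s+1}=\mathfrak m^sI$ for all $I\in\mathcal F$ and all $s\ge 1$; - for every $I\ne 0$ in $\mathcal F$ there are a finite chain $0=I_0\subsetneq I_1\subsetneq\dots\subsetneq I_n=I$ and elements $x_j\in I_j\setminus I_{j-1}$ such that, for $j=1,\dots,n$, $I_j\in\mathcal F$, $I_j=I_{j-1}+(x_j)$ and $I_{j-1}:x_j\in\mathcal F$. (2) Every finitely generated $R$-module $M$ with $\mathfrak q M=0$ is a Koszul module, i.e. has linearity defect $0$. Here the linearity defect of a finitely generated $R$-module $M$ is $\sup\{i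 : H_i(\operatorname{lin}^R F)\neq 0\}$ (and $0$ if $M=0$), where $F$ is the minimal free resolution of $M$ and its linear part $\operatorname{lin}^R F$ is the associated graded complex of $F$ for the filtration $(\mathcal G^nF)_i=\mathfrak m^{n-i}F_i$, with $\mathfrak m^j=R$ for $j\le 0$. -/

import Mathlib

open IsLocalRing CategoryTheory

universe u v

/-- A minimal free resolution
`⋯ ⟶ R ^ rank 2 ⟶ R ^ rank 1 ⟶ R ^ rank 0 ⟶ M ⟶ 0`
of a module `M` over a local ring `R` with maximal ideal `𝔪`: an exact complex of finite free
modules whose differentials map `F_{i+1}` into `𝔪 F_i`. -/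
structure MinimalFreeResolution (R : Type u) [CommRing R] [IsLocalRing R]
    (M : Type v) [AddCommGroup M] [Module R M] where
  /-- the rank of the free module in degree `i` -/
  rank : ℕ → ℕ
  /-- the differential `F_{i+1} ⟶ F_i` -/
  d : ∀ i : ℕ, (Fin (rank (i + 1)) → R) →ₗ[R] (Fin (rank i) → R)
  /-- the augmentation `F_0 ⟶ M` -/
  ε : (Fin (rank 0) → R) →ₗ[R] M
  surjective_ε : Function.Surjective ε
  exact_ε : Function.Exact (d 0) ε
  exact_d : ∀ i : ℕ, Function.Exact (d (i + 1)) (d i)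
  minimal : ∀ i : ℕ, LinearMap.range (d i) ≤
    maximalIdeal R • (⊤ : Submodule R (Fin (rank i) → R))

namespace MinimalFreeResolution

section LinearPart

variable {R : Type u} [CommRing R] [IsLocalRing R] {M : Type v} [AddCommGroup M] [Module R M]
  (F : MinimalFreeResolution R M)

/-- The filtration `(𝒢ⁿ F)_i = 𝔪 ^ (n - i) F_i`. The truncated subtraction of natural numbers
encodes the convention `𝔪 ^ j = R` for `j ≤ 0`. -/
def filtration (n i : ℕ) : Submodule R (Fin (F.rank i) → R) :=
  maximalIdeal R ^ (n - i) • (⊤ : Submodule R (Fin (F.rank i) → R))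

theorem d_mem_filtration (n n' i : ℕ) (h : n ≤ n') (x : Fin (F.rank (i + 1)) → R)
    (hx : x ∈ F.filtration n' (i + 1)) : F.d i x ∈ F.filtration n i := by
  have h1 : Submodule.map (F.d i) (F.filtration n' (i + 1)) ≤ F.filtration n i := by
    unfold filtration
    rw [Submodule.map_smul'', Submodule.map_top]
    refine (smul_mono_right _ (F.minimal i)).trans ?_
    rw [← Submodule.mul_smul, ← pow_succ]
    exact Submodule.smul_mono_left (Ideal.pow_le_pow_right (by omega))
  exact h1 (Submodule.mem_map_of_mem hx)

/-- The graded piece `(𝒢ⁿ F)_i / (𝒢ⁿ⁺¹ F)_i`. -/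
def gr (n i : ℕ) : Type u :=
  F.filtration n i ⧸ (F.filtration (n + 1) i).submoduleOf (F.filtration n i)

instance (n i : ℕ) : AddCommGroup (F.gr n i) :=
  inferInstanceAs (AddCommGroup
    (F.filtration n i ⧸ (F.filtration (n + 1) i).submoduleOf (F.filtration n i)))

instance (n i : ℕ) : Module R (F.gr n i) :=
  inferInstanceAs (Module R
    (F.filtration n i ⧸ (F.filtration (n + 1) i).submoduleOf (F.filtration n i)))

/-- The map `(𝒢ⁿ F)_{i+1} / (𝒢ⁿ⁺¹ F)_{i+1} ⟶ (𝒢ⁿ F)_i / (𝒢ⁿ⁺¹ F)_i` induced by the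
differential. -/
def grD (n i : ℕ) : F.gr n (i + 1) →ₗ[R] F.gr n i :=
  Submodule.mapQ _ _
    ((F.d i).restrict (fun x hx => F.d_mem_filtration n n i le_rfl x hx))
    (fun x hx => F.d_mem_filtration (n + 1) (n + 1) i le_rfl x.1 hx)

theorem grD_grD (n i : ℕ) (x : F.gr n (i + 1 + 1)) : F.grD n i (F.grD n (i + 1) x) = 0 := by
  obtain ⟨x, rfl⟩ := Submodule.Quotient.mk_surjective _ x
  have h : F.d i (F.d (i + 1) x.1) = 0 := (F.exact_d i).apply_apply_eq_zero x.1
  refine (Submodule.Quotient.mk_eq_zero _).2 ?_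
  change F.d i (F.d (i + 1) x.1) ∈ F.filtration (n + 1) i
  rw [h]
  exact Submodule.zero_mem _

/-- The linear part of `F`: the associated graded complex
`⨁ₙ (𝒢ⁿ F) / (𝒢ⁿ⁺¹ F)` of the filtration `𝒢`, with the differential induced by that of `F`. -/
noncomputable def linearPart : ChainComplex (ModuleCat.{u} R) ℕ :=
  ChainComplex.of
    (fun i => ModuleCat.of R (DirectSum ℕ (fun n => F.gr n i)))
    (fun i => ModuleCat.ofHom (DirectSum.lmap (fun n => F.grD n i)))
    (fun i => ModuleCat.hom_ext (LinearMap.ext fun x =>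
      DFinsupp.ext (β := fun n => F.gr n i) fun n => F.grD_grD n i (x n)))

end LinearPart

section Existence

variable {R : Type u} [CommRing R] [IsLocalRing R]

/-- A finitely generated module over a local ring has a free cover `R ^ n ⟶ M` whose kernel lies
in `𝔪 R ^ n`. -/
theorem exists_cover (R : Type u) [CommRing R] [IsLocalRing R]
    (M : Type v) [AddCommGroup M] [Module R M] [Module.Finite R M] :
    ∃ (n : ℕ) (f : (Fin n → R) →ₗ[R] M), Function.Surjective f ∧
      LinearMap.ker f ≤ maximalIdeal R • (⊤ : Submodule R (Fin n → R)) := by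
  classical
  have hex : ∃ n : ℕ, ∃ v : Fin n → M, Submodule.span R (Set.range v) = ⊤ :=
    Module.Finite.exists_fin
  obtain ⟨v, hv⟩ := Nat.find_spec hex
  have hmin := fun m (hm : m < Nat.find hex) => Nat.find_min hex hm
  generalize Nat.find hex = n at v hv hmin
  refine ⟨n, Fintype.linearCombination R v, ?_, ?_⟩
  · rw [← LinearMap.range_eq_top, Fintype.range_linearCombination, hv]
  · intro x hx
    have hx0 : ∑ i, x i • v i = 0 := by
      simpa [Fintype.linearCombination_apply] using hx
    have hmem : ∀ j, x j ∈ maximalIdeal R := by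
      intro j
      by_contra hj
      have hu : IsUnit (x j) := by
        simpa [mem_maximalIdeal, mem_nonunits_iff] using hj
      obtain ⟨c, hc⟩ := hu.exists_left_inv
      obtain ⟨k, rfl⟩ : ∃ k, n = k + 1 := ⟨n - 1, by have := j.2; omega⟩
      refine hmin k (Nat.lt_succ_self k) ⟨v ∘ j.succAbove, ?_⟩
      rw [eq_top_iff, ← hv, Submodule.span_le]
      have hs : ∀ i : Fin k, v (j.succAbove i) ∈
          Submodule.span R (Set.range (v ∘ j.succAbove)) :=
        fun i => Submodule.subset_span ⟨i, rfl⟩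
      rintro _ ⟨i, rfl⟩
      rcases Fin.eq_self_or_eq_succAbove j i with h | ⟨i', rfl⟩
      · subst h
        rw [Fin.sum_univ_succAbove _ i] at hx0
        have h1 : v i = -(c • ∑ l, x (i.succAbove l) • v (i.succAbove l)) := by
          rw [← eq_neg_iff_add_eq_zero] at hx0
          rw [← smul_neg, ← hx0, smul_smul, hc, one_smul]
        rw [h1]
        exact Submodule.neg_mem _ (Submodule.smul_mem _ _
          (Submodule.sum_mem _ fun l _ => Submodule.smul_mem _ _ (hs l)))
      · exact hs i'
    have hx1 : x = ∑ i, x i • (Pi.single i (1 : R) : Fin n → R) := pi_eq_sum_univ' x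
    rw [hx1]
    exact Submodule.sum_mem _ fun i _ => Submodule.smul_mem_smul (hmem i) Submodule.mem_top

/-- Every finitely generated module over a noetherian local ring has a minimal free resolution. -/
theorem nonempty (R : Type u) [CommRing R] [IsLocalRing R] [IsNoetherianRing R]
    (M : Type v) [AddCommGroup M] [Module R M] [Module.Finite R M] :
    Nonempty (MinimalFreeResolution R M) := by
  obtain ⟨n₀, f₀, hf₀, hk₀⟩ := exists_cover R M
  have hstep : ∀ s : (Σ n : ℕ, Submodule R (Fin n → R)), ∃ (n : ℕ) (f : (Fin n → R) →ₗ[R] s.2),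
      Function.Surjective f ∧
      LinearMap.ker f ≤ maximalIdeal R • (⊤ : Submodule R (Fin n → R)) :=
    fun s => exists_cover R s.2
  choose N f hf hk using hstep
  let S : ℕ → (Σ n : ℕ, Submodule R (Fin n → R)) := fun i =>
    Nat.rec ⟨n₀, LinearMap.ker f₀⟩ (fun _ s => ⟨N s, LinearMap.ker (f s)⟩) i
  let D : ∀ i : ℕ, (Fin (S (i + 1)).1 → R) →ₗ[R] (Fin (S i).1 → R) :=
    fun i => (S i).2.subtype.comp (f (S i))
  have hrange : ∀ i, LinearMap.range (D i) = (S i).2 := by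
    intro i
    have h : LinearMap.range (f (S i)) = ⊤ := LinearMap.range_eq_top.2 (hf (S i))
    change LinearMap.range ((S i).2.subtype.comp (f (S i))) = (S i).2
    rw [LinearMap.range_comp, h, Submodule.map_top, Submodule.range_subtype]
  have hker : ∀ i, LinearMap.ker (D i) = (S (i + 1)).2 := by
    intro i
    change LinearMap.ker ((S i).2.subtype.comp (f (S i))) = LinearMap.ker (f (S i))
    rw [LinearMap.ker_comp, Submodule.ker_subtype, Submodule.comap_bot]
  refine ⟨⟨fun i => (S i).1, D, f₀, hf₀, ?_, ?_, ?_⟩⟩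
  · exact LinearMap.exact_iff.2 (hrange 0).symm
  · exact fun i => LinearMap.exact_iff.2 ((hker i).trans (hrange (i + 1)).symm)
  · intro i
    refine (hrange i).le.trans ?_
    cases i with
    | zero => exact hk₀
    | succ i => exact hk (S i)

end Existence

end MinimalFreeResolution

/-- The linearity defect `sup {i : H_i (linear part of F) ≠ 0}` of `M`, where `F` is the minimal
free resolution of `M`; it is a value in `ℕ ∪ {∞}`, and the supremum of the empty set is `0`, so
that the zero module has linearity defect `0`. As the minimal free resolution exists and is unique
up to isomorphism, the supremum over all minimal free resolutions `F` is the value at any one. -/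
noncomputable def linearityDefect (R : Type u) [CommRing R] [IsLocalRing R] [IsNoetherianRing R]
    (M : Type v) [AddCommGroup M] [Module R M] [Module.Finite R M] : ℕ∞ :=
  ⨆ F : MinimalFreeResolution R M,
    sSup {t : ℕ∞ | ∃ i : ℕ, t = i ∧ ¬ Limits.IsZero (F.linearPart.homology i)}

/-- A finitely generated module over a noetherian local ring is a Koszul module if its linearity
defect is `0`. -/
def IsKoszulModule (R : Type u) [CommRing R] [IsLocalRing R] [IsNoetherianRing R]
    (M : Type v) [AddCommGroup M] [Module R M] [Module.Finite R M] : Prop :=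
  linearityDefect R M = 0

/-- A collection `𝓕` of ideals of a local ring `R` with maximal ideal `𝔪` is a Koszul
filtration. -/
structure IsKoszulFiltration {R : Type u} [CommRing R] [IsLocalRing R]
    (𝓕 : Set (Ideal R)) : Prop where
  bot_mem : ⊥ ∈ 𝓕
  maximalIdeal_mem : maximalIdeal R ∈ 𝓕
  inf_pow : ∀ I ∈ 𝓕, ∀ s : ℕ, 1 ≤ s → I ⊓ maximalIdeal R ^ (s + 1) = maximalIdeal R ^ s * I
  /-- Every nonzero `I` in `𝓕` has a finite chain `0 = J 0 ⊂ J 1 ⊂ ⋯ ⊂ J n = I` of members of `𝓕`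
  with `J (j + 1) = J j + (x j)`, `x j ∉ J j` and `J j : x j` in `𝓕`. -/
  exists_chain : ∀ I ∈ 𝓕, I ≠ ⊥ → ∃ (n : ℕ) (J : ℕ → Ideal R) (x : ℕ → R),
    J 0 = ⊥ ∧ J n = I ∧ ∀ j < n,
      J j < J (j + 1) ∧ x j ∈ J (j + 1) ∧ x j ∉ J j ∧ J (j + 1) ∈ 𝓕 ∧
      J (j + 1) = J j ⊔ Ideal.span {x j} ∧ (J j).colon {x j} ∈ 𝓕

/-- `y_1, …, y_e` is a minimal generating set of the ideal `q`: it generates `q`, and no `y_i` can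
be left out. -/
def IsMinimalGeneratingFamily {R : Type u} [CommRing R] (q : Ideal R) {e : ℕ} (y : Fin e → R) :
    Prop :=
  Ideal.span (Set.range y) = q ∧ ∀ i : Fin e, Ideal.span (y '' {j | j ≠ i}) ≠ q

/-- The collection
`{0, (y_1), (y_1, y_2), …, (y_1, …, y_{e-1})} ∪ {I : q ⊆ I ⊆ 𝔪}` of ideals. -/
def chainAndIdealsContaining {R : Type u} [CommRing R] [IsLocalRing R] (q : Ideal R) {e : ℕ}
    (y : Fin e → R) : Set (Ideal R) :=
  {I | I = ⊥ ∨ ∃ i : ℕ, 1 ≤ i ∧ i < e ∧ I = Ideal.span (y '' {j | (j : ℕ) < i})} ∪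
    {I | q ≤ I ∧ I ≤ maximalIdeal R}

/-!
Part (1). Since `𝔪³ = 0` and `𝔪 I = 𝔪²` for `𝔮 ⊆ I ⊆ 𝔪`, the intersection condition only has content
for `I = (y₁, …, yᵢ)` and `𝔪²`. An element of `I ∩ 𝔪²` is a combination of `y₁, …, yᵢ` lying in
`𝔪𝔮`, so by Nakayama its coefficients lie in `𝔪`. Chains are built by adjoining one element at a
time. The colon ideals `J : x` that occur contain `𝔮`: either `x ∈ 𝔮` and `𝔮² = 0`, or `𝔮 ⊆ J`.

Part (2). The linear part of `F` is exact in positive degrees once `d` is strict for the filtration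
`𝒢`, and this follows from `𝔪² Fᵢ ⊆ 𝔪 Zᵢ`, where `Zᵢ ⊆ Fᵢ` is the image of the differential. As
`𝔪² = 𝔪𝔮`, it would suffice that `𝔮 Fᵢ ⊆ Zᵢ`. This holds for `i = 0`, since `𝔮M = 0`, but not
in general. Instead `Fᵢ` carries a finite filtration `0 = G₀ ⊆ G₁ ⊆ ⋯ ⊆ Gᵢ₊₁ = Fᵢ` with
`𝔮 Gₖ₊₁ ⊆ Zᵢ + 𝔪 Gₖ`, and then `𝔪² Gₖ₊₁ ⊆ 𝔪 Zᵢ + 𝔪² Gₖ` gives the claim by induction on `k`.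
-/

section Chains

theorem exists_seq_of_reflTransGen {α : Type*} {r : α → α → Prop} {a b : α}
    (h : Relation.ReflTransGen r a b) :
    ∃ (n : ℕ) (f : ℕ → α), f 0 = a ∧ f n = b ∧ ∀ j < n, r (f j) (f (j + 1)) := by
  induction h using Relation.ReflTransGen.head_induction_on with
  | refl => exact ⟨0, fun _ => b, rfl, rfl, fun _ hj => absurd hj (Nat.not_lt_zero _)⟩
  | @head a _ hac _ ih =>
    obtain ⟨n, f, rfl, hn, hf⟩ := ih
    refine ⟨n + 1, fun | 0 => a | j + 1 => f j, rfl, hn, fun j hj => ?_⟩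
    cases j with
    | zero => exact hac
    | succ j => exact hf j (Nat.lt_of_succ_lt_succ hj)

variable {R : Type*} [CommRing R]

/-- One step `I ⊂ J = I + (x)` of a chain in a Koszul filtration `𝓕`. Membership of `I` in `𝓕` is
not recorded, since chains start at `0 ∈ 𝓕`. -/
def IsKoszulStep (𝓕 : Set (Ideal R)) (I J : Ideal R) : Prop :=
  J ∈ 𝓕 ∧ ∃ x ∉ I, J = I ⊔ Ideal.span {x} ∧ I.colon {x} ∈ 𝓕

theorem lt_sup_span_singleton {I : Ideal R} {x : R} (hx : x ∉ I) : I < I ⊔ Ideal.span {x} :=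
  left_lt_sup.2 fun h => hx ((Ideal.span_singleton_le_iff_mem I).1 h)

theorem exists_chain_of_reflTransGen {𝓕 : Set (Ideal R)} {I : Ideal R}
    (h : Relation.ReflTransGen (IsKoszulStep 𝓕) ⊥ I) :
    ∃ (n : ℕ) (J : ℕ → Ideal R) (x : ℕ → R), J 0 = ⊥ ∧ J n = I ∧ ∀ j < n,
      J j < J (j + 1) ∧ x j ∈ J (j + 1) ∧ x j ∉ J j ∧ J (j + 1) ∈ 𝓕 ∧
      J (j + 1) = J j ⊔ Ideal.span {x j} ∧ (J j).colon {x j} ∈ 𝓕 := by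
  obtain ⟨n, J, h0, hn, hJ⟩ := exists_seq_of_reflTransGen h
  choose! hmem x hx hsup hcolon using hJ
  refine ⟨n, J, x, h0, hn, fun j hj =>
    ⟨?_, ?_, hx j hj, hmem j hj, hsup j hj, hcolon j hj⟩⟩
  · exact hsup j hj ▸ lt_sup_span_singleton (hx j hj)
  · exact hsup j hj ▸ Ideal.mem_sup_right (Ideal.mem_span_singleton_self _)

theorem reflTransGen_of_forall_sup_span_singleton [IsNoetherianRing R]
    {r : Ideal R → Ideal R → Prop} {I J : Ideal R} (hIJ : I ≤ J)
    (hr : ∀ K, I ≤ K → ∀ x ∉ K, K ⊔ Ideal.span {x} ≤ J → r K (K ⊔ Ideal.span {x})) :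
    Relation.ReflTransGen r I J := by
  induction I using WellFoundedGT.induction with
  | _ I ih =>
    rcases hIJ.eq_or_lt with rfl | hlt
    · exact .refl
    obtain ⟨x, hxJ, hxI⟩ := SetLike.exists_of_lt hlt
    have hle : I ⊔ Ideal.span {x} ≤ J := sup_le hIJ ((Ideal.span_singleton_le_iff_mem J).2 hxJ)
    exact .head (hr I le_rfl x hxI hle) (ih _ (lt_sup_span_singleton hxI) hle
      fun K hK => hr K (le_sup_left.trans hK))

end Chains

section Ideals

variable {R : Type*} [CommRing R]

theorem pow_three_eq_bot_of_sq_eq_mul {I q : Ideal R} (hI : I ^ 2 = q * I) (hq : q ^ 2 = ⊥) :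
    I ^ 3 = ⊥ :=
  calc I ^ 3 = q * I * I := by rw [pow_succ, hI]
    _ = q ^ 2 * I := by rw [mul_assoc, ← sq, hI, sq, mul_assoc]
    _ = ⊥ := by rw [hq, Ideal.bot_mul]

theorem inf_pow_succ_eq_pow_mul {I J : Ideal R} (hI : I ^ 3 = ⊥) (hJI : J ≤ I)
    (hJ : J ⊓ I ^ 2 ≤ I * J) {s : ℕ} (hs : 1 ≤ s) : J ⊓ I ^ (s + 1) = I ^ s * J := by
  refine le_antisymm ?_ (le_inf Ideal.mul_le_right (pow_succ I s ▸ Ideal.mul_mono_right hJI))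
  rcases hs.eq_or_lt with rfl | hs
  · rwa [pow_one]
  · calc J ⊓ I ^ (s + 1) ≤ I ^ 3 := inf_le_right.trans (Ideal.pow_le_pow_right (by lia))
      _ ≤ I ^ s * J := hI ▸ bot_le

theorem colon_singleton_le_maximalIdeal [IsLocalRing R] {I : Ideal R} {x : R} (hx : x ∉ I) :
    I.colon {x} ≤ maximalIdeal R := by
  refine le_maximalIdeal fun h => hx ?_
  simpa using Submodule.mem_colon_singleton.1 ((Ideal.eq_top_iff_one _).1 h)

/-- The ideal generated by the first `i` members of `y`. -/
def spanPrefix {e : ℕ} (y : Fin e → R) (i : ℕ) : Ideal R :=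
  Ideal.span (y '' {j | (j : ℕ) < i})

variable {e : ℕ} (y : Fin e → R)

theorem spanPrefix_zero : spanPrefix y 0 = ⊥ := by simp [spanPrefix]

theorem spanPrefix_length : spanPrefix y e = Ideal.span (Set.range y) := by simp [spanPrefix]

theorem spanPrefix_succ (i : Fin e) :
    spanPrefix y (i + 1) = spanPrefix y i ⊔ Ideal.span {y i} := by
  rw [spanPrefix, spanPrefix, ← Ideal.span_union, ← Set.image_singleton, ← Set.image_union]
  congr 2
  ext j
  simp only [Set.mem_ofPred_eq, Set.mem_union, Set.mem_singleton_iff, Fin.ext_iff]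
  lia

end Ideals

namespace IsMinimalGeneratingFamily

variable {R : Type*} [CommRing R] {q : Ideal R} {e : ℕ} {y : Fin e → R}

theorem mem (hy : IsMinimalGeneratingFamily q y) (i : Fin e) : y i ∈ q :=
  hy.1 ▸ Ideal.subset_span ⟨i, rfl⟩

theorem fg (hy : IsMinimalGeneratingFamily q y) : q.FG :=
  hy.1 ▸ Submodule.fg_span (Set.finite_range y)

theorem spanPrefix_le (hy : IsMinimalGeneratingFamily q y) (i : ℕ) : spanPrefix y i ≤ q :=
  hy.1 ▸ Ideal.span_mono (Set.image_subset_range y _)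

theorem not_le_span_ne (hy : IsMinimalGeneratingFamily q y) (i : Fin e) :
    ¬ q ≤ Ideal.span (y '' {j | j ≠ i}) := fun h =>
  hy.2 i (le_antisymm (hy.1 ▸ Ideal.span_mono (Set.image_subset_range y _)) h)

theorem le_of_span_ne_le (hy : IsMinimalGeneratingFamily q y) {J : Ideal R} {i : Fin e}
    (hJ : Ideal.span (y '' {j | j ≠ i}) ≤ J) (hi : y i ∈ J) : q ≤ J := by
  rw [← hy.1, Ideal.span_le]
  rintro _ ⟨j, rfl⟩
  by_cases hj : j = i
  · exact hj ▸ hi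
  · exact hJ (Ideal.subset_span ⟨j, hj, rfl⟩)

theorem notMem_spanPrefix (hy : IsMinimalGeneratingFamily q y) (i : Fin e) :
    y i ∉ spanPrefix y i := fun h =>
  hy.not_le_span_ne i (hy.le_of_span_ne_le le_rfl
    (Ideal.span_mono (Set.image_mono fun _ hj => Fin.ne_of_lt hj) h))

variable [IsLocalRing R]

theorem coeff_mem_maximalIdeal (hy : IsMinimalGeneratingFamily q y) {l : Fin e →₀ R}
    (hl : Finsupp.linearCombination R y l ∈ maximalIdeal R * q) (i : Fin e) :
    l i ∈ maximalIdeal R := by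
  by_contra hi
  have hu : IsUnit (l i) := notMem_maximalIdeal.1 hi
  set Q := Ideal.span (y '' {j | j ≠ i})
  have hrest : ∑ j ∈ Finset.univ.erase i, l j • y j ∈ Q := Submodule.sum_mem _ fun j hj =>
    Submodule.smul_mem _ _ (Ideal.subset_span ⟨j, Finset.ne_of_mem_erase hj, rfl⟩)
  have hyi : y i ∈ Q ⊔ maximalIdeal R * q := by
    rw [← Ideal.unit_mul_mem_iff_mem _ hu, ← smul_eq_mul (l i),
      ← Submodule.add_mem_iff_left _ (Ideal.mem_sup_left hrest),
      Finset.add_sum_erase _ (fun j => l j • y j) (Finset.mem_univ i)]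
    rw [Finsupp.linearCombination_apply, Finsupp.sum_fintype _ _ (by simp)] at hl
    exact Ideal.mem_sup_right hl
  exact hy.not_le_span_ne i (Submodule.le_of_le_smul_of_le_jacobson_bot hy.fg
    (maximalIdeal_le_jacobson _) (hy.le_of_span_ne_le le_sup_left hyi))

theorem spanPrefix_inf_le (hy : IsMinimalGeneratingFamily q y) (i : ℕ) :
    spanPrefix y i ⊓ maximalIdeal R * q ≤ maximalIdeal R * spanPrefix y i := by
  rintro x ⟨hx, hxm⟩
  obtain ⟨l, hl, rfl⟩ := (Finsupp.mem_span_image_iff_linearCombination R).1 hx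
  rw [Finsupp.linearCombination_apply]
  exact Submodule.sum_mem _ fun j hj => Ideal.mul_mem_mul (hy.coeff_mem_maximalIdeal hxm j)
    (Ideal.subset_span ⟨j, hl hj, rfl⟩)

theorem mem_chainAndIdealsContaining_iff (hy : IsMinimalGeneratingFamily q y)
    (hqm : q ≤ maximalIdeal R) {I : Ideal R} : I ∈ chainAndIdealsContaining q y ↔
      (∃ i ≤ e, I = spanPrefix y i) ∨ (q ≤ I ∧ I ≤ maximalIdeal R) := by
  constructor
  · rintro ((rfl | ⟨i, -, hi, rfl⟩) | hI)
    · exact .inl ⟨0, Nat.zero_le _, (spanPrefix_zero y).symm⟩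
    · exact .inl ⟨i, hi.le, rfl⟩
    · exact .inr hI
  · rintro (⟨i, hi, rfl⟩ | hI)
    · rcases Nat.eq_zero_or_pos i with rfl | h0
      · exact .inl (.inl (spanPrefix_zero y))
      rcases hi.eq_or_lt with rfl | he
      · exact .inr (by rw [spanPrefix_length, hy.1]; exact ⟨le_rfl, hqm⟩)
      · exact .inl (.inr ⟨i, h0, he, rfl⟩)
    · exact .inr hI

theorem inf_sq_le (hy : IsMinimalGeneratingFamily q y) (hqm : q ≤ maximalIdeal R)
    (hm : maximalIdeal R ^ 2 = q * maximalIdeal R) {I : Ideal R}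
    (hI : I ∈ chainAndIdealsContaining q y) :
    I ⊓ maximalIdeal R ^ 2 ≤ maximalIdeal R * I := by
  rw [hm, mul_comm q]
  rcases (hy.mem_chainAndIdealsContaining_iff hqm).1 hI with ⟨i, -, rfl⟩ | ⟨hqI, -⟩
  · exact hy.spanPrefix_inf_le i
  · exact inf_le_right.trans (Ideal.mul_mono_right hqI)

theorem reflTransGen_spanPrefix (hy : IsMinimalGeneratingFamily q y) (hqm : q ≤ maximalIdeal R)
    (hq : q ^ 2 = ⊥) {i : ℕ} (hi : i ≤ e) :
    Relation.ReflTransGen (IsKoszulStep (chainAndIdealsContaining q y)) ⊥ (spanPrefix y i) := by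
  induction i with
  | zero => rw [spanPrefix_zero]
  | succ i ih =>
    have hyi : y ⟨i, hi⟩ ∉ spanPrefix y i := hy.notMem_spanPrefix ⟨i, hi⟩
    have hcolon : q ≤ (spanPrefix y i).colon {y ⟨i, hi⟩} := fun r hr => by
      have h0 : r * y ⟨i, hi⟩ ∈ q ^ 2 := sq q ▸ Ideal.mul_mem_mul hr (hy.mem _)
      exact Submodule.mem_colon_singleton.2 ((hq ▸ bot_le : q ^ 2 ≤ spanPrefix y i) h0)
    exact (ih (Nat.le_of_succ_le hi)).tail
      ⟨(hy.mem_chainAndIdealsContaining_iff hqm).2 (.inl ⟨i + 1, hi, rfl⟩),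
        y ⟨i, hi⟩, hyi, spanPrefix_succ y ⟨i, hi⟩,
        .inr ⟨hcolon, colon_singleton_le_maximalIdeal hyi⟩⟩

theorem reflTransGen_of_le [IsNoetherianRing R] {I : Ideal R} (hqI : q ≤ I)
    (hI : I ≤ maximalIdeal R) :
    Relation.ReflTransGen (IsKoszulStep (chainAndIdealsContaining q y)) q I :=
  reflTransGen_of_forall_sup_span_singleton hqI fun K hqK x hx hKI =>
    have hcolon : q ≤ K.colon {x} := fun _ hr =>
      Submodule.mem_colon_singleton.2 (Ideal.mul_mem_right _ _ (hqK hr))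
    ⟨.inr ⟨hqK.trans le_sup_left, hKI.trans hI⟩, x, hx, rfl,
      .inr ⟨hcolon, colon_singleton_le_maximalIdeal hx⟩⟩

theorem isKoszulFiltration [IsNoetherianRing R] (hy : IsMinimalGeneratingFamily q y)
    (hqm : q ≤ maximalIdeal R) (hm : maximalIdeal R ^ 2 = q * maximalIdeal R) (hq : q ^ 2 = ⊥) :
    IsKoszulFiltration (chainAndIdealsContaining q y) where
  bot_mem := .inl (.inl rfl)
  maximalIdeal_mem := .inr ⟨hqm, le_rfl⟩
  inf_pow I hI s hs := by
    have hIm : I ≤ maximalIdeal R := by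
      rcases (hy.mem_chainAndIdealsContaining_iff hqm).1 hI with ⟨i, -, rfl⟩ | ⟨-, hIm⟩
      exacts [(hy.spanPrefix_le i).trans hqm, hIm]
    exact inf_pow_succ_eq_pow_mul (pow_three_eq_bot_of_sq_eq_mul hm hq) hIm
      (hy.inf_sq_le hqm hm hI) hs
  exists_chain I hI _ := by
    apply exists_chain_of_reflTransGen
    rcases (hy.mem_chainAndIdealsContaining_iff hqm).1 hI with ⟨i, hi, rfl⟩ | ⟨hqI, hIm⟩
    · exact hy.reflTransGen_spanPrefix hqm hq hi
    · have hpath := hy.reflTransGen_spanPrefix hqm hq le_rfl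
      rw [spanPrefix_length, hy.1] at hpath
      exact hpath.trans (reflTransGen_of_le hqI hIm)

end IsMinimalGeneratingFamily

section LinearSyzygies

variable {R : Type*} [CommRing R] {I q : Ideal R}
  {F : ℕ → Type*} [∀ i, AddCommGroup (F i)] [∀ i, Module R (F i)] {d : ∀ i, F (i + 1) →ₗ[R] F i}

variable (I q d) in
/-- The filtration `0 = G₀ ⊆ G₁ ⊆ ⋯` of the terms of a complex `(F, d)` with `G₁ F₀ = F₀`, for which
an element of `F_{i+1}` lies in `G_{k+1}` if its boundary lies in `q F_i + I G_k`. It measures how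
far `q F_i` is from consisting of boundaries. -/
def syzygyLayer : ℕ → ∀ i, Submodule R (F i)
  | 0, _ => ⊥
  | _ + 1, 0 => ⊤
  | k + 1, i + 1 => (q • ⊤ ⊔ I • syzygyLayer k i).comap (d i)

theorem syzygyLayer_le_succ (k i : ℕ) : syzygyLayer I q d k i ≤ syzygyLayer I q d (k + 1) i := by
  induction k generalizing i with
  | zero => exact bot_le
  | succ k ih =>
    cases i with
    | zero => exact le_rfl
    | succ i => exact Submodule.comap_mono (sup_le_sup_left (smul_mono_right I (ih i)) _)

theorem syzygyLayer_eq_top (hmin : ∀ i, LinearMap.range (d i) ≤ I • ⊤) (i : ℕ) :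
    syzygyLayer I q d (i + 1) i = ⊤ := by
  induction i with
  | zero => rfl
  | succ i ih =>
    rw [syzygyLayer, ih, eq_top_iff, ← LinearMap.range_le_iff_comap.1 (hmin i)]
    exact Submodule.comap_mono le_sup_right

theorem map_syzygyLayer_succ (k i : ℕ) :
    (syzygyLayer I q d (k + 1) (i + 1)).map (d i) =
      LinearMap.range (d i) ⊓ (q • ⊤ ⊔ I • syzygyLayer I q d k i) :=
  Submodule.map_comap_eq _ _

theorem smul_smul_eq_of_sq_eq_mul (hI : I ^ 2 = q * I) {M : Type*} [AddCommGroup M] [Module R M]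
    (N : Submodule R M) : I • I • N = I • q • N := by
  rw [← Submodule.mul_smul, ← Submodule.mul_smul, ← sq, hI, mul_comm]

theorem smul_smul_syzygyLayer_le (hI : I ^ 2 = q * I) {i : ℕ}
    (h : ∀ k, q • syzygyLayer I q d (k + 1) i ≤ LinearMap.range (d i) ⊔ I • syzygyLayer I q d k i)
    (k : ℕ) :
    I • q • syzygyLayer I q d k i ≤ I • (syzygyLayer I q d k (i + 1)).map (d i) := by
  induction k with
  | zero => simp [syzygyLayer]
  | succ k ih =>
    have hsplit : q • syzygyLayer I q d (k + 1) i ≤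
        (syzygyLayer I q d (k + 1) (i + 1)).map (d i) ⊔ I • syzygyLayer I q d k i := by
      rw [map_syzygyLayer_succ, inf_comm, inf_sup_assoc_of_le _ le_sup_right]
      exact le_inf ((smul_mono_right q le_top).trans le_sup_left) (h k)
    calc I • q • syzygyLayer I q d (k + 1) i
        ≤ I • ((syzygyLayer I q d (k + 1) (i + 1)).map (d i) ⊔ I • syzygyLayer I q d k i) :=
          smul_mono_right I hsplit
      _ = I • (syzygyLayer I q d (k + 1) (i + 1)).map (d i) ⊔ I • q • syzygyLayer I q d k i := by
          rw [Submodule.smul_sup, smul_smul_eq_of_sq_eq_mul hI]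
      _ ≤ I • (syzygyLayer I q d (k + 1) (i + 1)).map (d i) :=
          sup_le le_rfl <| ih.trans <| smul_mono_right I <|
            Submodule.map_mono (syzygyLayer_le_succ _ _)

theorem smul_syzygyLayer_succ_le (hI : I ^ 2 = q * I) (hq : q ^ 2 = ⊥)
    (hexact : ∀ i, Function.Exact (d (i + 1)) (d i)) (hq0 : q • ⊤ ≤ LinearMap.range (d 0))
    (i k : ℕ) :
    q • syzygyLayer I q d (k + 1) i ≤ LinearMap.range (d i) ⊔ I • syzygyLayer I q d k i := by
  induction i generalizing k with
  | zero => exact hq0.trans le_sup_left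
  | succ i ih =>
    rw [← LinearMap.exact_iff.1 (hexact i), sup_comm, ← Submodule.comap_map_eq,
      ← Submodule.map_le_iff_le_comap, Submodule.map_smul'', Submodule.map_smul'']
    calc q • (syzygyLayer I q d (k + 1) (i + 1)).map (d i)
        ≤ q • (q • ⊤ ⊔ I • syzygyLayer I q d k i) :=
          smul_mono_right q (Submodule.map_comap_le _ _)
      _ = I • q • syzygyLayer I q d k i := by
          rw [Submodule.smul_sup, ← Submodule.mul_smul, ← sq, hq, Submodule.bot_smul, bot_sup_eq,
            ← Submodule.mul_smul, mul_comm, Submodule.mul_smul]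
      _ ≤ I • (syzygyLayer I q d k (i + 1)).map (d i) := smul_smul_syzygyLayer_le hI ih k

theorem sq_smul_top_le_smul_range (hI : I ^ 2 = q * I) (hq : q ^ 2 = ⊥)
    (hexact : ∀ i, Function.Exact (d (i + 1)) (d i)) (hmin : ∀ i, LinearMap.range (d i) ≤ I • ⊤)
    (hq0 : q • ⊤ ≤ LinearMap.range (d 0)) (i : ℕ) :
    I ^ 2 • (⊤ : Submodule R (F i)) ≤ I • LinearMap.range (d i) :=
  calc I ^ 2 • (⊤ : Submodule R (F i)) = I • q • syzygyLayer I q d (i + 1) i := by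
        rw [syzygyLayer_eq_top hmin, hI, mul_comm, Submodule.mul_smul]
    _ ≤ I • (syzygyLayer I q d (i + 1) (i + 1)).map (d i) :=
        smul_smul_syzygyLayer_le hI (smul_syzygyLayer_succ_le hI hq hexact hq0 i) _
    _ ≤ I • LinearMap.range (d i) := smul_mono_right I LinearMap.map_le_range

end LinearSyzygies

namespace MinimalFreeResolution

variable {R : Type u} [CommRing R] [IsLocalRing R] {M : Type v} [AddCommGroup M] [Module R M]
  (F : MinimalFreeResolution R M)

theorem smul_top_le_range_d {q : Ideal R} (hM : q • (⊤ : Submodule R M) = ⊥) :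
    q • ⊤ ≤ LinearMap.range (F.d 0) := by
  rw [← LinearMap.exact_iff.1 F.exact_ε, ← Submodule.comap_bot, ← Submodule.map_le_iff_le_comap,
    Submodule.map_smul'', ← hM]
  exact smul_mono_right q le_top

theorem filtration_succ_le (n i : ℕ) : F.filtration (n + 1) i ≤ F.filtration n i :=
  Submodule.smul_mono_left (Ideal.pow_le_pow_right (by lia))

theorem range_d_inf_filtration_le
    (h : ∀ i, maximalIdeal R ^ 2 • ⊤ ≤ maximalIdeal R • LinearMap.range (F.d i)) (n i : ℕ) :
    LinearMap.range (F.d i) ⊓ F.filtration n i ≤ (F.filtration n (i + 1)).map (F.d i) := by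
  rw [filtration, filtration, Submodule.map_smul'', Submodule.map_top]
  rcases Nat.lt_or_ge n (i + 2) with hn | hn
  · rw [show n - (i + 1) = 0 by lia, pow_zero, Ideal.one_eq_top, Submodule.top_smul]
    exact inf_le_left
  · obtain ⟨s, rfl⟩ := Nat.exists_eq_add_of_le hn
    rw [show i + 2 + s - i = s + 2 by lia, show i + 2 + s - (i + 1) = s + 1 by lia, pow_add _ s 2,
      pow_succ _ s, Submodule.mul_smul, Submodule.mul_smul]
    exact inf_le_right.trans (smul_mono_right _ (h i))

theorem ker_grD_le_range_grD (hstrict : ∀ n i, LinearMap.range (F.d i) ⊓ F.filtration n i ≤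
      (F.filtration n (i + 1)).map (F.d i)) (n i : ℕ) :
    LinearMap.ker (F.grD n i) ≤ LinearMap.range (F.grD n (i + 1)) := by
  intro x hx
  obtain ⟨⟨x, hxn⟩, rfl⟩ := Submodule.Quotient.mk_surjective _ x
  have hdx : F.d i x ∈ F.filtration (n + 1) i :=
    (Submodule.Quotient.mk_eq_zero ((F.filtration (n + 1) i).submoduleOf (F.filtration n i))).1 hx
  obtain ⟨x', hx', hdx'⟩ := hstrict (n + 1) i ⟨⟨x, rfl⟩, hdx⟩
  have hcycle : x - x' ∈ LinearMap.range (F.d (i + 1)) :=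
    (F.exact_d i _).1 (by rw [map_sub, hdx', sub_self])
  obtain ⟨y, hy, hyx⟩ := hstrict n (i + 1)
    ⟨hcycle, Submodule.sub_mem _ hxn (F.filtration_succ_le n (i + 1) hx')⟩
  refine ⟨Submodule.Quotient.mk ⟨y, hy⟩, (Submodule.Quotient.eq _).2 ?_⟩
  change F.d (i + 1) y - x ∈ F.filtration (n + 1) (i + 1)
  rw [hyx, sub_sub_cancel_left]
  exact Submodule.neg_mem _ hx'

theorem linearPart_d (i : ℕ) :
    F.linearPart.d (i + 1) i = ModuleCat.ofHom (DirectSum.lmap fun n => F.grD n i) :=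
  ChainComplex.of_d (fun i => ModuleCat.of R (DirectSum ℕ fun n => F.gr n i))
    (fun i => ModuleCat.ofHom (DirectSum.lmap fun n => F.grD n i)) i

theorem isZero_homology_linearPart
    (h : ∀ n i, LinearMap.ker (F.grD n i) ≤ LinearMap.range (F.grD n (i + 1))) (i : ℕ) :
    Limits.IsZero (F.linearPart.homology (i + 1)) := by
  rw [← HomologicalComplex.exactAt_iff_isZero_homology,
    HomologicalComplex.exactAt_iff' _ (i + 2) (i + 1) i (by simp) (by simp),
    ShortComplex.moduleCat_exact_iff_ker_sub_range]
  change LinearMap.ker (F.linearPart.d (i + 1) i).hom ≤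
    LinearMap.range (F.linearPart.d (i + 1 + 1) (i + 1)).hom
  rw [linearPart_d, linearPart_d]
  change LinearMap.ker (DirectSum.lmap fun n => F.grD n i) ≤
    LinearMap.range (DirectSum.lmap fun n => F.grD n (i + 1))
  rw [DirectSum.ker_lmap, DirectSum.range_lmap]
  exact Submodule.comap_mono (Submodule.pi_mono fun n _ => h n i)

end MinimalFreeResolution

theorem isKoszulModule_of_isZero_homology_linearPart {R : Type u} [CommRing R] [IsLocalRing R]
    [IsNoetherianRing R] {M : Type v} [AddCommGroup M] [Module R M] [Module.Finite R M]
    (h : ∀ (F : MinimalFreeResolution R M) (i : ℕ),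
      Limits.IsZero (F.linearPart.homology (i + 1))) : IsKoszulModule R M := by
  refine le_antisymm (iSup_le fun F => sSup_le ?_) bot_le
  rintro _ ⟨i, rfl, hi⟩
  cases i with
  | zero => exact le_rfl
  | succ i => exact absurd (h F i) hi

theorem proposition5p12 {R : Type u} [CommRing R] [IsLocalRing R] [IsNoetherianRing R]
    (q : Ideal R) (hqm : q ≤ maximalIdeal R)
    (hm : maximalIdeal R ^ 2 = q * maximalIdeal R) (hq : q ^ 2 = ⊥) :
    (∀ (e : ℕ) (y : Fin e → R), IsMinimalGeneratingFamily q y →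
      IsKoszulFiltration (chainAndIdealsContaining q y)) ∧
    ∀ (M : Type v) [AddCommGroup M] [Module R M] [Module.Finite R M],
      q • (⊤ : Submodule R M) = ⊥ → IsKoszulModule R M := by
  refine ⟨fun e y hy => hy.isKoszulFiltration hqm hm hq, fun M _ _ _ hM =>
    isKoszulModule_of_isZero_homology_linearPart fun F => ?_⟩
  have hsq : ∀ i, maximalIdeal R ^ 2 • ⊤ ≤ maximalIdeal R • LinearMap.range (F.d i) :=
    sq_smul_top_le_smul_range hm hq F.exact_d F.minimal (F.smul_top_le_range_d hM)
  exact F.isZero_homology_linearPart (F.ker_grD_le_range_grD (F.range_d_inf_filtration_le hsq))
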